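/- Let $G$ be a second countable, locally compact Hausdorff topological groupoid with unit space $G^0$, domain map $d$ and range map $r$. Let $(\mathcal H^\pi,\pi)$ be a continuous unitary representation of $G$: $\mathcal H^\pi=\{\mathcal H^\pi_u\}_{u\in G^0}$ is a continuous field of separable Hilbert spaces over $G^0$; the operators $\pi(x)\colon\mathcal H^\pi_{d(x)}\to\mathcal H^\pi_{r(x)}$ are unitary, with $\pi(u)=\mathrm{id}$ for $u\in G^0$, $\pi(x)\pi(y)=\pi(xy)$ for composable $x,y$, and $\pi(x^{-1})=\pi(x)^{-1}$; and $x\mapsto\langle\pi(x)\xi(d(x)),\eta(r(x))\rangle$ is continuous on $G$ for all $\xi,\eta$ in the Hilbert $C_0(G^0)$-module $C_0(G^0,\mathcal H^\pi)$ of continuous sections vanishing at infinity. Assume that this Hilbert module is countably generated. For an adjointable operator $T$ on $C_0(G^0,\mathcal H^\pi)$ let $T_u$, $u\in G^0$, be its localization, that is, the bounded operator on $\mathcal H^\pi_u$ with $T_u(\xi(u))=(T\xi)(u)$ for all $\xi$. For $p=1,2$, $T$ is in the Schatten class $\mathcal L^p$ (trace class for $p=1$, Hilbert–Schmidt for $p=2$)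 if the function $u\mapsto\mathrm{tr}\,|T_u|^p$ is finite and belongs to $C_0(G^0)$, and then $\|T\|_p=\sup_{u}\|T_u\|_p$ with $\|T_u\|_p=(\mathrm{tr}\,|T_u|^p)^{1/p}$. For $x\in G$ and an operator $A$ on $\mathcal H^\pi_{d(x)}$ put $x\cdot A=\pi(x)A\pi(x^{-1})$, an operator on $\mathcal H^\pi_{r(x)}$. The representation $\pi$ is called amenable if there is a net $(T^i)_{i\in I}$ of Hilbert–Schmidt operators on $C_0(G^0,\mathcal H^\pi)$ with $\|T^i\|_2\le 1$ for all $i$, such that $\|T^i_u\|_2\to1$ uniformly on compact subsets of $G^0$ and $\langle x\cdot T^i_{d(x)},T^i_{r(x)}\rangle\to1$ (Hilbert–Schmidt inner product) uniformly on compact subsets of $G$. Then $\pi$ is amenable if and only if there is a net $(S^i)_{i\in I}$ of positive trace-class operators on $C_0(G^0,\mathcal H^\pi)$ with $\|S^i\|_1\le1$ for all $i$, such that $\|S^i_u\|_1\to1$ uniformly on compact subsets of $G^0$ and $\|x\cdot S^i_{d(x)}-S^i_{r(x)}\|_1\to0$ uniformly on compact subsets of $G$. -/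

import Mathlib

open CategoryTheory Filter Topology
open scoped ENNReal NNReal ZeroAtInfty InnerProductSpace

/-! Below, `⟪x, y⟫_ℂ` always refers to the inner product of `InnerProductSpace`. -/

attribute [-instance] WithCStarModule.instCStarModuleComplex

/-! ### Topological groupoids

A groupoid is a small category in which every morphism is invertible. Its objects `X` are the units,
the set `G` of all its elements is `Arrow X`; for `x : Arrow X`, the domain `d(x)` is `x.left` and
the range `r(x)` is `x.right`. The product `x y` (defined when `d(x) = r(y)`) is "first `y`, then
`x`". -/

/-- The inverse of an element of a groupoid. -/
def Gpd.inv {X : Type*} [Groupoid X] (x : Arrow X) : Arrow X :=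
  Arrow.mk (Groupoid.inv x.hom)

/-- The product `x y` of a composable pair, `d(x) = r(y)`. -/
def Gpd.mul {X : Type*} [Groupoid X] (x y : Arrow X) (h : x.left = y.right) : Arrow X :=
  Arrow.mk (y.hom ≫ eqToHom h.symm ≫ x.hom)

/-- A topological groupoid: inversion is continuous, multiplication is continuous on the set of
composable pairs with the topology induced from the product, and the unit space carries the
topology induced by `u ↦ 𝟙 u`. -/
class TopologicalGroupoid (X : Type*) [Groupoid X] [TopologicalSpace X]
    [TopologicalSpace (Arrow X)] : Prop where
  isEmbedding_unit : IsEmbedding (fun u : X => Arrow.mk (𝟙 u))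
  continuous_inv : Continuous (fun x : Arrow X => Gpd.inv x)
  continuous_mul : Continuous
    (fun p : {p : Arrow X × Arrow X // p.1.left = p.2.right} => Gpd.mul p.1.1 p.1.2 p.2)

section UnitSpace

variable {X : Type*} [Groupoid X] [TopologicalSpace X] [TopologicalSpace (Arrow X)]
  [TopologicalGroupoid X]

theorem TopologicalGroupoid.continuous_unit_left :
    Continuous (fun x : Arrow X => Arrow.mk (𝟙 x.left)) := by
  have h : Continuous (fun x : Arrow X =>
      (⟨(Gpd.inv x, x), rfl⟩ : {p : Arrow X × Arrow X // p.1.left = p.2.right})) :=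
    Continuous.subtype_mk (TopologicalGroupoid.continuous_inv.prodMk continuous_id) _
  have h2 := TopologicalGroupoid.continuous_mul.comp h
  refine h2.congr fun x => ?_
  simp only [Function.comp, Gpd.mul, Gpd.inv]
  congr 1
  erw [Category.id_comp]
  exact Groupoid.comp_inv _

theorem TopologicalGroupoid.isClosedEmbedding_unit [T2Space (Arrow X)] :
    IsClosedEmbedding (fun u : X => Arrow.mk (𝟙 u)) := by
  refine ⟨TopologicalGroupoid.isEmbedding_unit, ?_⟩
  have : Set.range (fun u : X => Arrow.mk (𝟙 u)) = {x : Arrow X | Arrow.mk (𝟙 x.left) = x} := by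
    ext x
    constructor
    · rintro ⟨u, rfl⟩
      rfl
    · intro h
      exact ⟨x.left, h⟩
  rw [this]
  exact isClosed_eq TopologicalGroupoid.continuous_unit_left continuous_id

/-- The unit space of a Hausdorff groupoid is Hausdorff. -/
instance TopologicalGroupoid.t2Space_unit [T2Space (Arrow X)] : T2Space X :=
  (TopologicalGroupoid.isEmbedding_unit (X := X)).t2Space

/-- The unit space of a locally compact Hausdorff groupoid is locally compact. -/
instance TopologicalGroupoid.locallyCompactSpace_unit [T2Space (Arrow X)]
    [LocallyCompactSpace (Arrow X)] : LocallyCompactSpace X :=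
  (TopologicalGroupoid.isClosedEmbedding_unit (X := X)).locallyCompactSpace

end UnitSpace

/-! ### Continuous fields of Hilbert spaces -/

/-- A continuous field of separable Hilbert spaces `(H u)` over `X`; `sections` is the space `Γ`
of its continuous sections. -/
structure ContinuousField (X : Type*) [TopologicalSpace X] (H : X → Type*)
    [∀ u, NormedAddCommGroup (H u)] [∀ u, InnerProductSpace ℂ (H u)]
    [∀ u, CompleteSpace (H u)] where
  sections : Submodule ℂ (∀ u, H u)
  separable : ∀ u, TopologicalSpace.SeparableSpace (H u)
  dense : ∀ u, Dense {h : H u | ∃ ξ ∈ sections, ξ u = h}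
  continuous_norm : ∀ ξ ∈ sections, Continuous (fun u => ‖ξ u‖)
  mem_of_locally_approx : ∀ ξ : ∀ u, H u,
    (∀ u, ∀ ε > (0 : ℝ), ∃ ξ' ∈ sections, ∀ᶠ s in 𝓝 u, ‖ξ s - ξ' s‖ < ε) → ξ ∈ sections

namespace ContinuousField

section Basic

variable {X : Type*} [TopologicalSpace X] {H : X → Type*}
  [∀ u, NormedAddCommGroup (H u)] [∀ u, InnerProductSpace ℂ (H u)] [∀ u, CompleteSpace (H u)]
  (F : ContinuousField X H)

/-- The space `C₀(X, H)` of continuous sections vanishing at infinity. -/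
def C0 : Submodule ℂ (∀ u, H u) where
  carrier := {ξ | ξ ∈ F.sections ∧ Tendsto (fun u => ‖ξ u‖) (cocompact X) (𝓝 0)}
  zero_mem' := ⟨F.sections.zero_mem, by simpa using tendsto_const_nhds⟩
  add_mem' := by
    rintro ξ η ⟨h1, h2⟩ ⟨h3, h4⟩
    refine ⟨F.sections.add_mem h1 h3, ?_⟩
    refine squeeze_zero (fun u => norm_nonneg _) (fun u => norm_add_le _ _) ?_
    simpa using h2.add h4
  smul_mem' := by
    rintro c ξ ⟨h1, h2⟩
    refine ⟨F.sections.smul_mem c h1, ?_⟩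
    simpa [norm_smul] using h2.const_mul ‖c‖

instance : CoeFun F.C0 (fun _ => ∀ u, H u) := ⟨fun ξ => ξ.1⟩

variable {F}

theorem continuous_inner {ξ η : ∀ u, H u} (hξ : ξ ∈ F.sections) (hη : η ∈ F.sections) :
    Continuous (fun u => ⟪ξ u, η u⟫_ℂ) := by
  have h1 := F.continuous_norm _ (F.sections.add_mem hξ hη)
  have h2 := F.continuous_norm _ (F.sections.sub_mem hξ hη)
  have h3 := F.continuous_norm _ (F.sections.sub_mem hξ (F.sections.smul_mem Complex.I hη))
  have h4 := F.continuous_norm _ (F.sections.add_mem hξ (F.sections.smul_mem Complex.I hη))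
  simp only [Pi.add_apply, Pi.sub_apply, Pi.smul_apply] at h1 h2 h3 h4
  simp_rw [inner_eq_sum_norm_sq_div_four]
  simp only [RCLike.I_to_complex]
  fun_prop

/-- Continuous sections may be multiplied by continuous functions. -/
theorem smul_mem_sections {f : X → ℂ} (hf : Continuous f) {ξ : ∀ u, H u} (hξ : ξ ∈ F.sections) :
    (fun u => f u • ξ u) ∈ F.sections := by
  refine F.mem_of_locally_approx _ fun u ε hε => ⟨f u • ξ, F.sections.smul_mem _ hξ, ?_⟩
  have hc : Continuous (fun s => ‖f s - f u‖ * ‖ξ s‖) :=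
    ((hf.sub continuous_const).norm).mul (F.continuous_norm ξ hξ)
  have := hc.tendsto u
  simp only [sub_self, norm_zero, zero_mul] at this
  filter_upwards [this.eventually_lt_const hε] with s hs
  simpa [← sub_smul, norm_smul] using hs

variable (F)

/-- The `C₀(X)`-valued inner product on `C₀(X, H)`, `⟨ξ, η⟩(u) = ⟨ξ(u), η(u)⟩` (conjugate linear in
the first variable). -/
noncomputable def c0Inner (ξ η : F.C0) : C₀(X, ℂ) where
  toFun u := ⟪ξ u, η u⟫_ℂ
  continuous_toFun := continuous_inner ξ.2.1 η.2.1
  zero_at_infty' := by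
    rw [tendsto_zero_iff_norm_tendsto_zero]
    refine squeeze_zero (fun u => norm_nonneg _) (fun u => norm_inner_le_norm _ _) ?_
    simpa using ξ.2.2.mul η.2.2

/-- The `C₀(X)`-module structure of `C₀(X, H)`, `(f ξ)(u) = f(u) ξ(u)`. -/
noncomputable instance : SMul C₀(X, ℂ) F.C0 where
  smul f ξ := ⟨fun u => f u • ξ u, smul_mem_sections f.continuous ξ.2.1, by
    simp only [norm_smul]
    simpa using f.zero_at_infty'.norm.mul ξ.2.2⟩

@[simp] theorem smul_apply (f : C₀(X, ℂ)) (ξ : F.C0) (u : X) :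
    (f • ξ : F.C0) u = f u • ξ u := rfl

@[simp] theorem c0Inner_apply (ξ η : F.C0) (u : X) : F.c0Inner ξ η u = ⟪ξ u, η u⟫_ℂ := rfl

/-- The Hilbert module `C₀(X, H)` is countably generated: for some sequence of sections, the
`C₀(X)`-linear combinations of its terms are dense in `C₀(X, H)` for the norm
`‖ξ‖ = ‖⟨ξ, ξ⟩‖ ^ (1/2) = sup_u ‖ξ(u)‖`. -/
def CountablyGenerated : Prop :=
  ∃ e : ℕ → F.C0, ∀ ξ : F.C0, ∀ ε > (0 : ℝ), ∃ (N : ℕ) (f : ℕ → C₀(X, ℂ)),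
    ‖F.c0Inner (ξ - ∑ n ∈ Finset.range N, f n • e n) (ξ - ∑ n ∈ Finset.range N, f n • e n)‖ ^
      (1 / 2 : ℝ) < ε

/-- An adjointable operator on the Hilbert module `C₀(X, H)`, that is, an element of
`𝓛(C₀(X, H))`. (The adjoint is unique, and linearity is automatic.) -/
structure AdjointableOp where
  toFun : F.C0 → F.C0
  exists_adjoint : ∃ T' : F.C0 → F.C0, ∀ ξ η, F.c0Inner (toFun ξ) η = F.c0Inner ξ (T' η)

instance : CoeFun F.AdjointableOp (fun _ => F.C0 → F.C0) := ⟨fun T => T.toFun⟩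

variable {F}

/-- `T` is positive: `⟨ξ, T ξ⟩ ≥ 0` in `C₀(X)` for every `ξ`. -/
def AdjointableOp.IsPositive (T : F.AdjointableOp) : Prop :=
  ∀ (ξ : F.C0) (u : X), ∃ a : ℝ, 0 ≤ a ∧ F.c0Inner ξ (T ξ) u = (a : ℂ)

end Basic

/-! ### Localization of adjointable operators at a point -/

section Localization

variable {X : Type*} [TopologicalSpace X] [T2Space X] [LocallyCompactSpace X] {H : X → Type*}
  [∀ u, NormedAddCommGroup (H u)] [∀ u, InnerProductSpace ℂ (H u)] [∀ u, CompleteSpace (H u)]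
  {F : ContinuousField X H}

theorem exists_approx (u : X) (h : H u) {ε c : ℝ} (hε : 0 < ε) (hc : ‖h‖ < c) :
    ∃ ξ : F.C0, ‖h - ξ u‖ < ε ∧ ∀ s, ‖ξ s‖ ≤ c := by
  obtain ⟨k, hk, ⟨η, hη, rfl⟩⟩ := Metric.dense_iff.1 (F.dense u) h (min ε (c - ‖h‖))
    (lt_min hε (sub_pos.2 hc))
  rw [Metric.mem_ball, dist_eq_norm, lt_min_iff] at hk
  have hηu : ‖η u‖ < c := by
    have := norm_add_le h (η u - h)
    rw [add_sub_cancel] at this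
    linarith [hk.2]
  have hcont := F.continuous_norm η hη
  have hclosed : IsClosed {s | c ≤ ‖η s‖} := isClosed_le continuous_const hcont
  obtain ⟨f, hf1, hf0, hfc, hf⟩ := exists_continuous_one_zero_of_isCompact
    (isCompact_singleton (x := u)) hclosed (by simpa using hηu)
  have hfu : f u = 1 := hf1 rfl
  have hmem : (fun s => (f s : ℂ) • η s) ∈ F.C0 := by
    refine ⟨smul_mem_sections (by fun_prop) hη, ?_⟩
    have : (fun s => ‖(f s : ℂ) • η s‖) =ᶠ[cocompact X] 0 := by
      have h1 := hfc.isCompact.compl_mem_cocompact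
      filter_upwards [h1] with s hs
      simp [image_eq_zero_of_notMem_tsupport hs]
    exact tendsto_const_nhds.congr' this.symm
  refine ⟨⟨_, hmem⟩, ?_, fun s => ?_⟩
  · simp only [hfu, Complex.ofReal_one, one_smul]
    rw [norm_sub_rev]
    exact hk.1
  · simp only [norm_smul, Complex.norm_real, Real.norm_eq_abs, abs_of_nonneg (hf s).1]
    by_cases hs : c ≤ ‖η s‖
    · rw [hf0 hs]
      simpa using (norm_nonneg h).trans hc.le
    · push Not at hs
      calc f s * ‖η s‖ ≤ 1 * ‖η s‖ := by gcongr; exact (hf s).2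
        _ ≤ c := by linarith

/-- Every vector of a fibre is the value of a continuous section vanishing at infinity. -/
theorem exists_section (u : X) (h : H u) : ∃ ξ : F.C0, ξ u = h := by
  have step : ∀ (n : ℕ) (h : H u), ∃ ξ : F.C0, ‖h‖ < (1 / 2 : ℝ) ^ n →
      ‖h - ξ u‖ < (1 / 2) ^ (n + 1) ∧ ∀ s, ‖ξ s‖ ≤ (1 / 2) ^ n := by
    intro n h
    by_cases hn : ‖h‖ < (1 / 2 : ℝ) ^ n
    · obtain ⟨ξ, h1, h2⟩ := exists_approx (F := F) u h
        (ε := (1 / 2) ^ (n + 1)) (by positivity) hn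
      exact ⟨ξ, fun _ => ⟨h1, h2⟩⟩
    · exact ⟨0, fun h' => absurd h' hn⟩
  choose σ hσ using step
  -- it suffices to treat vectors of norm less than one
  suffices key : ∀ h : H u, ‖h‖ < 1 → ∃ ξ : F.C0, ξ u = h by
    have hpos : (0 : ℝ) < ‖h‖ + 1 := by positivity
    obtain ⟨ξ, hξ⟩ := key (((‖h‖ + 1 : ℝ) : ℂ)⁻¹ • h) (by
      rw [norm_smul, norm_inv, Complex.norm_real, Real.norm_of_nonneg hpos.le,
        inv_mul_lt_iff₀ hpos]
      linarith)
    refine ⟨((‖h‖ + 1 : ℝ) : ℂ) • ξ, ?_⟩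
    change ((‖h‖ + 1 : ℝ) : ℂ) • ξ u = h
    rw [hξ, smul_inv_smul₀]
    exact_mod_cast hpos.ne'
  intro h hh
  let r : ℕ → H u := fun n => Nat.rec h (fun n k => k - σ n k u) n
  have hr : ∀ n, ‖r n‖ < (1 / 2 : ℝ) ^ n := by
    intro n
    induction n with
    | zero => simpa [r] using hh
    | succ n ih => exact (hσ n (r n) ih).1
  let ξ : ℕ → F.C0 := fun n => σ n (r n)
  have hξ : ∀ n s, ‖ξ n s‖ ≤ (1 / 2 : ℝ) ^ n := fun n => (hσ n (r n) (hr n)).2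
  have hgeo : Summable (fun n : ℕ => (1 / 2 : ℝ) ^ n) := summable_geometric_two
  have hsum : ∀ s, Summable (fun n => ξ n s) := fun s =>
    Summable.of_norm_bounded hgeo (fun n => hξ n s)
  let ζ : ∀ s, H s := fun s => ∑' n, ξ n s
  let p : ℕ → F.C0 := fun N => ∑ n ∈ Finset.range N, ξ n
  have hp : ∀ N s, p N s = ∑ n ∈ Finset.range N, ξ n s := by
    intro N s
    simp [p]
  have htail : ∀ N s, ‖ζ s - p N s‖ ≤ ∑' n : ℕ, (1 / 2 : ℝ) ^ (n + N) := by
    intro N s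
    have h1 : ζ s - p N s = ∑' n, ξ (n + N) s := by
      rw [hp, sub_eq_iff_eq_add, add_comm]
      exact ((hsum s).sum_add_tsum_nat_add N).symm
    rw [h1]
    exact tsum_of_norm_bounded ((summable_nat_add_iff N).2 hgeo).hasSum (fun n => hξ _ s)
  have hlim : Tendsto (fun N : ℕ => ∑' n : ℕ, (1 / 2 : ℝ) ^ (n + N)) atTop (𝓝 0) :=
    tendsto_sum_nat_add _
  have hsec : ζ ∈ F.sections := by
    refine F.mem_of_locally_approx ζ fun v ε hε => ?_
    obtain ⟨N, hN⟩ := (hlim.eventually_lt_const hε).exists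
    exact ⟨p N, (p N).2.1, Eventually.of_forall fun s => (htail N s).trans_lt hN⟩
  have hzero : Tendsto (fun s => ‖ζ s‖) (cocompact X) (𝓝 0) := by
    rw [Metric.tendsto_nhds]
    intro ε hε
    obtain ⟨N, hN⟩ := (hlim.eventually_lt_const (half_pos hε)).exists
    filter_upwards [(p N).2.2.eventually_lt_const (half_pos hε)] with s hs
    rw [dist_zero_right, norm_norm]
    calc ‖ζ s‖ = ‖(ζ s - p N s) + p N s‖ := by rw [sub_add_cancel]
      _ ≤ ‖ζ s - p N s‖ + ‖p N s‖ := norm_add_le _ _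
      _ < ε := by linarith [htail N s]
  refine ⟨⟨ζ, hsec, hzero⟩, ?_⟩
  have hpr : ∀ N, p N u = h - r N := by
    intro N
    induction N with
    | zero => simp [hp, r]
    | succ N ih =>
      have : p (N + 1) u = p N u + ξ N u := by rw [hp, hp, Finset.sum_range_succ]
      rw [this, ih]
      change h - r N + ξ N u = h - (r N - ξ N u)
      abel
  have hr0 : Tendsto r atTop (𝓝 0) :=
    squeeze_zero_norm (fun n => (hr n).le)
      (tendsto_pow_atTop_nhds_zero_of_lt_one (by norm_num) (by norm_num))
  have h1 : Tendsto (fun N => p N u) atTop (𝓝 (ζ u)) := by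
    simp_rw [hp]
    exact (hsum u).hasSum.tendsto_sum_nat
  have h2 : Tendsto (fun N => p N u) atTop (𝓝 h) := by
    simp_rw [hpr]
    simpa using hr0.const_sub h
  exact tendsto_nhds_unique h1 h2

/-- An adjointable operator acts on each fibre: there is a bounded operator `A` on `H u` with
`A (ξ(u)) = (T ξ)(u)`. -/
theorem AdjointableOp.exists_loc (T : F.AdjointableOp) (u : X) :
    ∃ A : H u →L[ℂ] H u, ∀ ξ : F.C0, A (ξ u) = (T ξ) u := by
  obtain ⟨T', hT'⟩ := T.exists_adjoint
  have adj : ∀ ξ η : F.C0, ⟪(T ξ) u, η u⟫_ℂ = ⟪ξ u, (T' η) u⟫_ℂ := fun ξ η => by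
    have := DFunLike.congr_fun (hT' ξ η) u
    simpa using this
  choose σ hσ using exists_section (F := F) u
  have hB : ∀ (ξ : F.C0) (y : H u), ⟪(T ξ) u, y⟫_ℂ = ⟪ξ u, (T' (σ y)) u⟫_ℂ := fun ξ y => by
    rw [← adj, hσ]
  let A : H u →ₗ[ℂ] H u :=
    { toFun := fun h => (T (σ h)) u
      map_add' := fun x y => by
        refine ext_inner_right ℂ fun z => ?_
        rw [inner_add_left, hB, hB, hB, hσ, hσ, hσ, inner_add_left]
      map_smul' := fun c x => by
        refine ext_inner_right ℂ fun z => ?_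
        rw [RingHom.id_apply, inner_smul_left, hB, hB, hσ, hσ, inner_smul_left] }
  have hA : ∀ x y, ⟪A x, y⟫_ℂ = ⟪x, (T' (σ y)) u⟫_ℂ := fun x y => by
    change ⟪(T (σ x)) u, y⟫_ℂ = _
    rw [hB, hσ]
  have hcont : Continuous A := by
    refine A.continuous_of_seq_closed_graph fun w x y hw hy => ?_
    refine ext_inner_right ℂ fun z => ?_
    have h1 := hy.inner (tendsto_const_nhds (x := z)) (𝕜 := ℂ)
    have h2 := hw.inner (tendsto_const_nhds (x := (T' (σ z)) u)) (𝕜 := ℂ)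
    simp only [Function.comp, hA] at h1
    rw [hA]
    exact tendsto_nhds_unique h1 h2
  refine ⟨⟨A, hcont⟩, fun ξ => ?_⟩
  refine ext_inner_right ℂ fun z => ?_
  change ⟪A (ξ u), z⟫_ℂ = _
  rw [hA, hB]

/-- The localization `T_u` of `T` at `u`: the operator on the fibre `H u` with
`T_u (ξ(u)) = (T ξ)(u)` for every `ξ` in `C₀(X, H)`. -/
noncomputable def AdjointableOp.loc (T : F.AdjointableOp) (u : X) : H u →L[ℂ] H u :=
  (T.exists_loc u).choose

theorem AdjointableOp.loc_apply (T : F.AdjointableOp) (u : X) (ξ : F.C0) :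
    T.loc u (ξ u) = (T ξ) u :=
  (T.exists_loc u).choose_spec ξ

theorem AdjointableOp.loc_unique (T : F.AdjointableOp) (u : X) (A : H u →L[ℂ] H u)
    (hA : ∀ ξ : F.C0, A (ξ u) = (T ξ) u) : A = T.loc u := by
  ext h
  obtain ⟨ξ, rfl⟩ := exists_section (F := F) u h
  rw [hA, T.loc_apply]

end Localization

end ContinuousField

/-! ### Schatten classes -/

namespace Schatten

variable {E : Type*} [NormedAddCommGroup E] [InnerProductSpace ℂ E] [CompleteSpace E]

variable (E) in
/-- The index set of a fixed Hilbert basis of `E`. -/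
def basisSet : Set E := (exists_hilbertBasis ℂ E).choose

variable (E) in
/-- A fixed Hilbert basis (complete orthonormal system) of `E`. -/
noncomputable def basis : HilbertBasis (basisSet E) ℂ E :=
  (exists_hilbertBasis ℂ E).choose_spec.choose

/-- The trace of a positive bounded operator, in `[0, ∞]`. -/
noncomputable def trace (A : E →L[ℂ] E) : ℝ≥0∞ :=
  ∑' i, ENNReal.ofReal (⟪basis E i, A (basis E i)⟫_ℂ).re

/-- `tr |A| ^ p`, where `|A| = (A* A) ^ (1/2)`. -/
noncomputable def traceAbsPow (p : ℕ) (A : E →L[ℂ] E) : ℝ≥0∞ :=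
  trace (CFC.abs A ^ p)

/-- The Schatten norm `‖A‖_p = (tr |A| ^ p) ^ (1/p)`, in `[0, ∞]`. -/
noncomputable def norm (p : ℕ) (A : E →L[ℂ] E) : ℝ≥0∞ :=
  traceAbsPow p A ^ (1 / p : ℝ)

/-- The inner product `⟨A, B⟩ = tr (A* B)` of two Hilbert-Schmidt operators. -/
noncomputable def hsInner (A B : E →L[ℂ] E) : ℂ :=
  ∑' i, ⟪A (basis E i), B (basis E i)⟫_ℂ

end Schatten

namespace ContinuousField.AdjointableOp

variable {X : Type*} [TopologicalSpace X] [T2Space X] [LocallyCompactSpace X] {H : X → Type*}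
  [∀ u, NormedAddCommGroup (H u)] [∀ u, InnerProductSpace ℂ (H u)] [∀ u, CompleteSpace (H u)]
  {F : ContinuousField X H}

/-- `T` belongs to the Schatten class `𝓛^p(C₀(X, H))`: the function `u ↦ tr |T_u| ^ p` is finite
and lies in `C₀(X)`. The characters of `C₀(X)` are the points of `X`. -/
def MemSchatten (p : ℕ) (T : F.AdjointableOp) : Prop :=
  ∃ f : C₀(X, ℝ≥0), ∀ u, Schatten.traceAbsPow p (T.loc u) = f u

/-- The norm of `𝓛^p(C₀(X, H))`, `‖T‖_p = sup_u ‖T_u‖_p`. -/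
noncomputable def schattenNorm (p : ℕ) (T : F.AdjointableOp) : ℝ≥0∞ :=
  ⨆ u, Schatten.norm p (T.loc u)

end ContinuousField.AdjointableOp

/-! ### Unitary representations and amenability -/

/-- A continuous unitary representation of a groupoid on a continuous field of Hilbert spaces over
its unit space. -/
structure UnitaryRep {X : Type*} [Groupoid X] [TopologicalSpace X] [TopologicalSpace (Arrow X)]
    {H : X → Type*} [∀ u, NormedAddCommGroup (H u)] [∀ u, InnerProductSpace ℂ (H u)]
    [∀ u, CompleteSpace (H u)] (F : ContinuousField X H) where
  toFun : ∀ {u v : X}, (u ⟶ v) → (H u ≃ₗᵢ[ℂ] H v)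
  map_id : ∀ u : X, toFun (𝟙 u) = LinearIsometryEquiv.refl ℂ (H u)
  map_mul : ∀ {u v w : X} (y : u ⟶ v) (x : v ⟶ w) (h : H u), toFun (y ≫ x) h = toFun x (toFun y h)
  map_inv : ∀ {u v : X} (x : u ⟶ v), toFun (Groupoid.inv x) = (toFun x).symm
  continuous_coeff : ∀ ξ η : F.C0,
    Continuous (fun x : Arrow X => ⟪η x.right, toFun x.hom (ξ x.left)⟫_ℂ)

namespace UnitaryRep

variable {X : Type*} [Groupoid X] [TopologicalSpace X] [TopologicalSpace (Arrow X)]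
  {H : X → Type*} [∀ u, NormedAddCommGroup (H u)] [∀ u, InnerProductSpace ℂ (H u)]
  [∀ u, CompleteSpace (H u)] {F : ContinuousField X H}

/-- The operator `x · A = π(x) A π(x⁻¹)` on the fibre over `r(x)`, for an operator `A` on the fibre
over `d(x)`. -/
def act (π : UnitaryRep F) (x : Arrow X) (A : H x.left →L[ℂ] H x.left) :
    H x.right →L[ℂ] H x.right :=
  ((π.toFun x.hom).toContinuousLinearEquiv : H x.left →L[ℂ] H x.right) ∘L A ∘L
    ((π.toFun (Groupoid.inv x.hom)).toContinuousLinearEquiv : H x.right →L[ℂ] H x.left)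

/-- Amenability of a continuous unitary representation. -/
def IsAmenable [T2Space X] [LocallyCompactSpace X] (π : UnitaryRep F) : Prop :=
  ∃ (I : Type) (_ : Preorder I) (_ : IsDirectedOrder I) (_ : Nonempty I)
    (T : I → F.AdjointableOp),
    (∀ i, (T i).MemSchatten 2) ∧
    (∀ i, (T i).schattenNorm 2 ≤ 1) ∧
    (∀ K : Set X, IsCompact K →
      TendstoUniformlyOn (fun i u => (Schatten.norm 2 ((T i).loc u)).toReal) (fun _ => 1) atTop K) ∧
    (∀ K : Set (Arrow X), IsCompact K →
      TendstoUniformlyOn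
        (fun i x => Schatten.hsInner (π.act x ((T i).loc x.left)) ((T i).loc x.right))
        (fun _ => 1) atTop K)

end UnitaryRep

/-! ### Hilbert-Schmidt operators -/

namespace Schatten

/-! The correspondence is `S = T* T` in one direction and `T = √S` in the other, with the same index
set. It turns squared Hilbert-Schmidt norms into trace norms fibre by fibre, so membership in the
Schatten classes and the normalization carry over. Approximate invariance carries over by two
inequalities.

For Hilbert-Schmidt `A`, `B`, the identity `A* A - B* B = A* (A - B) + (A - B)* B` and
Cauchy-Schwarz give `‖A* A - B* B‖₁ ≤ (‖A‖₂ + ‖B‖₂) ‖A - B‖₂` (`traceAbsPow_one_sub_le`). If the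
norms are at most one, `‖A - B‖₂` is small once `Re ⟨A, B⟩` is close to one.

Conversely, for positive `A`, `B` the Powers-Størmer inequality `‖A - B‖₂² ≤ ‖A² - B²‖₁` holds
(`hsSq_sub_le_traceAbsPow`). Both inequalities are read off on the diagonal of an eigenbasis, of `A*
A - B* B` and of `A - B` respectively; these operators are compact and self-adjoint. They are
applied to `A = x · T_{d(x)}` and `B = T_{r(x)}`, since the action respects products, adjoints and
positivity.

The fibrewise square roots must also form an adjointable operator. The fibres of `S` are positive
contractions, so polynomials approximating the square root on `[0, 1]` do so in all fibres at once,
and the limit preserves continuous sections (`exists_loc_eq_sqrt`). -/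

theorem enorm_inner_symm {V : Type*} [NormedAddCommGroup V] [InnerProductSpace ℂ V] (x y : V) :
    ‖⟪x, y⟫_ℂ‖ₑ = ‖⟪y, x⟫_ℂ‖ₑ := by
  rw [← ofReal_norm, ← ofReal_norm, norm_inner_symm]

theorem enorm_inner_le {V : Type*} [NormedAddCommGroup V] [InnerProductSpace ℂ V] (x y : V) :
    ‖⟪x, y⟫_ℂ‖ₑ ≤ ‖x‖ₑ * ‖y‖ₑ := by
  rw [← ofReal_norm, ← ofReal_norm, ← ofReal_norm,
    ← ENNReal.ofReal_mul (norm_nonneg _)]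
  exact ENNReal.ofReal_le_ofReal (norm_inner_le_norm x y)

theorem enorm_sq_eq_ofReal {V : Type*} [NormedAddCommGroup V] (x : V) :
    ‖x‖ₑ ^ 2 = ENNReal.ofReal (‖x‖ ^ 2) := by
  rw [← ofReal_norm, ENNReal.ofReal_pow (norm_nonneg _)]

variable {E F K : Type*} [NormedAddCommGroup E] [InnerProductSpace ℂ E] [CompleteSpace E]
  [NormedAddCommGroup F] [InnerProductSpace ℂ F] [CompleteSpace F]
  [NormedAddCommGroup K] [InnerProductSpace ℂ K] [CompleteSpace K]

/-- The square of the Hilbert-Schmidt norm of a bounded operator, in `[0, ∞]`. -/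
noncomputable def hsSq (A : E →L[ℂ] F) : ℝ≥0∞ :=
  ∑' i, ‖A (basis E i)‖ₑ ^ 2

/-- Parseval's identity. -/
theorem tsum_enorm_inner_sq {V ι : Type*} [NormedAddCommGroup V] [InnerProductSpace ℂ V]
    (b : HilbertBasis ι ℂ V) (x : V) :
    ∑' i, ‖⟪b i, x⟫_ℂ‖ₑ ^ 2 = ‖x‖ₑ ^ 2 := by
  have h := b.hasSum_inner_mul_inner x x
  have h2 : HasSum (fun i => ‖⟪b i, x⟫_ℂ‖ ^ 2) (‖x‖ ^ 2) := by
    have h3 := Complex.hasSum_re h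
    have h4 : (⟪x, x⟫_ℂ).re = ‖x‖ ^ 2 := by
      simpa using inner_self_eq_norm_sq (𝕜 := ℂ) x
    rw [h4] at h3
    refine h3.congr_fun fun i => ?_
    rw [← inner_conj_symm x (b i), Complex.conj_mul']
    norm_cast
  simp only [enorm_sq_eq_ofReal]
  rw [← h2.tsum_eq, ENNReal.ofReal_tsum_of_nonneg (fun _ => by positivity) h2.summable]

/-- Parseval in the codomain gives a double series with terms in `[0, ∞]`, whose order of summation
may be exchanged. The right side does not involve `b`, which is the source of basis independence. -/
theorem tsum_enorm_sq_eq_hsSq_adjoint {ι : Type*} (b : HilbertBasis ι ℂ E) (A : E →L[ℂ] F) :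
    ∑' i, ‖A (b i)‖ₑ ^ 2 = hsSq (A.adjoint) := by
  have h1 : ∀ i, ‖A (b i)‖ₑ ^ 2 = ∑' j, ‖⟪b i, A.adjoint (basis F j)⟫_ℂ‖ₑ ^ 2 := fun i => by
    rw [← tsum_enorm_inner_sq (basis F)]
    refine tsum_congr fun j => ?_
    rw [enorm_inner_symm, ContinuousLinearMap.adjoint_inner_right]
  simp only [h1]
  rw [ENNReal.tsum_comm]
  exact tsum_congr fun j => tsum_enorm_inner_sq b _

theorem hsSq_adjoint (A : E →L[ℂ] F) : hsSq A.adjoint = hsSq A :=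
  (tsum_enorm_sq_eq_hsSq_adjoint (basis E) A).symm

/-- The Hilbert-Schmidt norm may be computed in any Hilbert basis. -/
theorem tsum_enorm_sq_eq_hsSq {ι : Type*} (b : HilbertBasis ι ℂ E) (A : E →L[ℂ] F) :
    ∑' i, ‖A (b i)‖ₑ ^ 2 = hsSq A := by
  rw [tsum_enorm_sq_eq_hsSq_adjoint, hsSq_adjoint]

theorem hsSq_comp_left {V W : Type*} [NormedAddCommGroup V] [InnerProductSpace ℂ V]
    [NormedAddCommGroup W] [InnerProductSpace ℂ W] (U : V ≃ₗᵢ[ℂ] W) (A : E →L[ℂ] V) :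
    hsSq ((U.toContinuousLinearEquiv : V →L[ℂ] W) ∘L A) = hsSq A := by
  refine tsum_congr fun i => ?_
  congr 1
  exact U.toLinearIsometry.enorm_map _

/-- Taking adjoints moves the unitary to the left, where it preserves the norm of each term. -/
theorem hsSq_comp_right (A : F →L[ℂ] K) (U : E ≃ₗᵢ[ℂ] F) :
    hsSq (A ∘L (U.toContinuousLinearEquiv : E →L[ℂ] F)) = hsSq A := by
  rw [← hsSq_adjoint, ContinuousLinearMap.adjoint_comp, ← hsSq_adjoint A]
  have : (U.toContinuousLinearEquiv : E →L[ℂ] F).adjoint =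
      (U.symm.toContinuousLinearEquiv : F →L[ℂ] E) := LinearIsometryEquiv.adjoint_eq_symm U
  rw [this, hsSq_comp_left]

/-- The coordinates of `A x` are `⟨A* b_j, x⟩`; Cauchy-Schwarz bounds each of them, and the sum of
`‖A* b_j‖²` is `hsSq A`. -/
theorem enorm_apply_sq_le (A : E →L[ℂ] F) (x : E) : ‖A x‖ₑ ^ 2 ≤ hsSq A * ‖x‖ₑ ^ 2 := by
  rw [← hsSq_adjoint, hsSq, ← ENNReal.tsum_mul_right, ← tsum_enorm_inner_sq (basis F)]
  refine ENNReal.tsum_le_tsum fun j => ?_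
  rw [← ContinuousLinearMap.adjoint_inner_left, ← mul_pow]
  gcongr
  exact enorm_inner_le _ _

theorem enorm_sq_le_hsSq (A : E →L[ℂ] F) : ‖A‖ₑ ^ 2 ≤ hsSq A := by
  by_cases h : hsSq A = ∞
  · simp [h]
  rw [enorm_sq_eq_ofReal]
  refine ENNReal.ofReal_le_of_le_toReal ?_
  rw [← Real.sqrt_le_sqrt_iff ENNReal.toReal_nonneg, Real.sqrt_sq (norm_nonneg _)]
  refine A.opNorm_le_bound (Real.sqrt_nonneg _) fun x => ?_
  rw [← Real.sqrt_sq (norm_nonneg x), ← Real.sqrt_mul ENNReal.toReal_nonneg]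
  refine Real.le_sqrt_of_sq_le ?_
  have := ENNReal.toReal_mono (ENNReal.mul_ne_top h (by simp)) (enorm_apply_sq_le A x)
  simpa using this

/-- Hilbert-Schmidt operators are compact. -/
theorem isCompactOperator_of_hsSq_ne_top {A : E →L[ℂ] F} (hA : hsSq A ≠ ∞) :
    IsCompactOperator A := by
  classical
  set b := basis E
  -- `P s` is the finite-rank truncation of `A` to the basis vectors in `s`. The squared
  -- Hilbert-Schmidt norm of `A - P s` is the complementary part of a convergent series, so `P s`
  -- tends to `A` in operator norm.
  let P : Finset (basisSet E) → E →L[ℂ] F := fun s =>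
    ∑ i ∈ s, (innerSL ℂ (b i)).smulRight (A (b i))
  have hP : ∀ s j, P s (b j) = if j ∈ s then A (b j) else 0 := fun s j => by
    simp only [P, sum_apply, ContinuousLinearMap.smulRight_apply,
      innerSL_apply_apply, orthonormal_iff_ite.1 b.orthonormal, ite_smul, one_smul, zero_smul,
      Finset.sum_ite_eq']
  have hcomp : ∀ s, IsCompactOperator (P s) := fun s => by
    refine Finset.sum_induction (fun i => (innerSL ℂ (b i)).smulRight (A (b i)))
      (fun T : E →L[ℂ] F => IsCompactOperator T) (fun S T hS hT => hS.add hT)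
      isCompactOperator_zero fun i _ => ?_
    exact (isCompactOperator_of_locallyCompactSpace_dom (innerSL ℂ (b i))).clm_comp
      (ContinuousLinearMap.toSpanSingleton ℂ (A (b i)))
  have hdiff : ∀ s, hsSq (A - P s) = ∑' i : {i // i ∉ s}, ‖A (b i)‖ₑ ^ 2 := fun s => by
    have : (∑' i : {i // i ∉ s}, ‖A (b i)‖ₑ ^ 2) =
        ∑' i, Set.indicator {i | i ∉ s} (fun i => ‖A (b i)‖ₑ ^ 2) i :=
      tsum_subtype {i | i ∉ s} (fun i => ‖A (b i)‖ₑ ^ 2)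
    rw [this]
    refine tsum_congr fun i => ?_
    rw [sub_apply]
    change ‖A (b i) - P s (b i)‖ₑ ^ 2 = _
    rw [hP]
    by_cases hi : i ∈ s <;> simp [hi, Set.indicator]
  refine isCompactOperator_of_tendsto (l := atTop) (F := P) ?_ (Eventually.of_forall hcomp)
  have h0 : Tendsto (fun s => hsSq (A - P s)) atTop (𝓝 0) := by
    simp only [hdiff]
    exact ENNReal.tendsto_tsum_compl_atTop_zero hA
  have h1 : Tendsto (fun s => ‖A - P s‖ₑ ^ 2) atTop (𝓝 0) :=
    tendsto_of_tendsto_of_tendsto_of_le_of_le tendsto_const_nhds h0 (fun _ => zero_le)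
      fun s => enorm_sq_le_hsSq _
  rw [tendsto_iff_norm_sub_tendsto_zero]
  have h2 := (ENNReal.tendsto_toReal ENNReal.zero_ne_top).comp h1
  have h3 := (Real.continuous_sqrt.tendsto _).comp h2
  simp only [ENNReal.toReal_zero, Real.sqrt_zero] at h3
  refine h3.congr fun s => ?_
  simp only [Function.comp, ENNReal.toReal_pow, toReal_enorm, Real.sqrt_sq (norm_nonneg _)]
  exact norm_sub_rev _ _

/-- An orthogonal family of closed subspaces spanning a dense subspace has an adapted Hilbert
basis. -/
theorem exists_hilbertBasis_mem.{u, v} {E : Type u} [NormedAddCommGroup E]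
    [InnerProductSpace ℂ E] [CompleteSpace E] {κ : Type v} (V : κ → Submodule ℂ E)
    [∀ μ, CompleteSpace (V μ)]
    (hV : OrthogonalFamily ℂ (fun μ => V μ) fun μ => (V μ).subtypeₗᵢ) (hbot : (⨆ μ, V μ)ᗮ = ⊥) :
    ∃ (ι : Type (max u v)) (b : HilbertBasis ι ℂ E) (f : ι → κ), ∀ i, b i ∈ V (f i) := by
  have horth : Orthonormal ℂ (fun a : Σ μ, basisSet (V μ) => ((basis (V a.1) a.2 : V a.1) : E)) :=
    hV.orthonormal_sigma_orthonormal
      (v_family := fun μ => basis (V μ)) fun μ => (basis (V μ)).orthonormal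
  have hbot : (Submodule.span ℂ (Set.range
      (fun a : Σ μ, basisSet (V μ) => ((basis (V a.1) a.2 : V a.1) : E))))ᗮ = ⊥ := by
    rw [eq_bot_iff, ← hbot]
    intro x hx
    rw [Submodule.mem_orthogonal] at hx ⊢
    -- A vector of `V μ` is the sum of its expansion in `basis (V μ)`, and `x` is orthogonal to
    -- every term.
    suffices h : (⨆ μ, V μ) ≤ (Submodule.span ℂ {x})ᗮ from fun u hu =>
      Submodule.inner_left_of_mem_orthogonal (Submodule.mem_span_singleton_self x) (h hu)
    refine iSup_le fun μ u hu => ?_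
    rw [Submodule.mem_orthogonal_singleton_iff_inner_right]
    have h1 := ((basis (V μ)).hasSum_repr ⟨u, hu⟩).mapL (V μ).subtypeL
    have h2 := h1.mapL (innerSL ℂ x)
    refine h2.unique ?_
    have : ∀ j, ⟪x, ((basis (V μ) j : V μ) : E)⟫_ℂ = 0 := fun j => by
      rw [inner_eq_zero_symm]
      exact hx _ (Submodule.subset_span ⟨⟨μ, j⟩, rfl⟩)
    simp [this, hasSum_zero]
  refine ⟨_, HilbertBasis.mkOfOrthogonalEqBot horth hbot, fun a => a.1, fun a => ?_⟩
  rw [HilbertBasis.coe_mkOfOrthogonalEqBot]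
  exact (basis (V a.1) a.2).2

/-- A compact self-adjoint operator has a Hilbert basis of eigenvectors. -/
theorem exists_hilbertBasis_eigenvectors.{u} {E : Type u} [NormedAddCommGroup E]
    [InnerProductSpace ℂ E] [CompleteSpace E] {C : E →L[ℂ] E} (hc : IsCompactOperator C)
    (hs : IsSelfAdjoint C) :
    ∃ (ι : Type u) (b : HilbertBasis ι ℂ E) (l : ι → ℝ), ∀ i, C (b i) = (l i : ℂ) • b i := by
  have hsym : (C : E →ₗ[ℂ] E).IsSymmetric := hs.isSymmetric
  have hcomplete : ∀ μ, CompleteSpace (Module.End.eigenspace (C : Module.End ℂ E) μ) := fun μ => by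
    refine IsClosed.completeSpace_coe (hs := ?_)
    have : (Module.End.eigenspace (C : Module.End ℂ E) μ : Set E) = {x | C x = μ • x} :=
      Set.ext fun x => Module.End.mem_eigenspace_iff
    rw [this]
    exact isClosed_eq C.continuous (by fun_prop)
  obtain ⟨ι, b, f, hb⟩ := exists_hilbertBasis_mem _ hsym.orthogonalFamily_eigenspaces
    (C.orthogonalComplement_iSup_eigenspaces_eq_bot hc hsym)
  -- Eigenvalues of a symmetric operator are real, so nothing is lost by taking real parts.
  refine ⟨ι, b, fun i => (f i).re, fun i => ?_⟩
  have hne : b i ≠ 0 := b.orthonormal.ne_zero i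
  have hreal := hsym.conj_eigenvalue_eq_self (Module.End.hasEigenvalue_of_hasEigenvector
    (Module.End.hasEigenvector_iff.2 ⟨hb i, hne⟩))
  rw [Complex.conj_eq_iff_re.1 hreal]
  exact Module.End.mem_eigenspace_iff.1 (hb i)

/-- The Cauchy-Schwarz inequality for sums in `[0, ∞]`. -/
theorem tsum_mul_le_sqrt_mul_sqrt {ι : Type*} (f g : ι → ℝ≥0∞) :
    ∑' i, f i * g i ≤ (∑' i, f i ^ 2) ^ (1 / 2 : ℝ) * (∑' i, g i ^ 2) ^ (1 / 2 : ℝ) := by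
  rw [ENNReal.tsum_eq_iSup_sum]
  refine iSup_le fun s => (ENNReal.inner_le_Lp_mul_Lq s f g Real.HolderConjugate.two_two).trans ?_
  simp only [ENNReal.rpow_two]
  gcongr <;> exact ENNReal.sum_le_tsum s

end Schatten

namespace Schatten

variable {E F : Type*} [NormedAddCommGroup E] [InnerProductSpace ℂ E] [CompleteSpace E]
  [NormedAddCommGroup F] [InnerProductSpace ℂ F] [CompleteSpace F]

/-! ### The trace norm -/

/-- The trace of a positive operator may be computed in any Hilbert basis. -/
theorem tsum_inner_eq_hsSq_sqrt {ι : Type*} (b : HilbertBasis ι ℂ E) {A : E →L[ℂ] E}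
    (hA : 0 ≤ A) :
    ∑' i, ENNReal.ofReal (⟪b i, A (b i)⟫_ℂ).re = hsSq (CFC.sqrt A) := by
  rw [← tsum_enorm_sq_eq_hsSq b]
  refine tsum_congr fun i => ?_
  have hs : IsSelfAdjoint (CFC.sqrt A) := (CFC.sqrt_nonneg A).isSelfAdjoint
  have h1 : ⟪b i, A (b i)⟫_ℂ = ⟪CFC.sqrt A (b i), CFC.sqrt A (b i)⟫_ℂ := by
    conv_lhs => rw [← CFC.sqrt_mul_sqrt_self A hA]
    exact (hs.isSymmetric _ _).symm
  rw [h1, enorm_sq_eq_ofReal, inner_self_eq_norm_sq_to_K]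
  norm_cast

theorem trace_eq_hsSq_sqrt {A : E →L[ℂ] E} (hA : 0 ≤ A) : trace A = hsSq (CFC.sqrt A) :=
  tsum_inner_eq_hsSq_sqrt (basis E) hA

theorem trace_eq_tsum {ι : Type*} (b : HilbertBasis ι ℂ E) {A : E →L[ℂ] E} (hA : 0 ≤ A) :
    trace A = ∑' i, ENNReal.ofReal (⟪b i, A (b i)⟫_ℂ).re := by
  rw [trace_eq_hsSq_sqrt hA, tsum_inner_eq_hsSq_sqrt b hA]

theorem trace_adjoint_comp_self (A : E →L[ℂ] F) : trace (A.adjoint ∘L A) = hsSq A := by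
  refine tsum_congr fun i => ?_
  rw [ContinuousLinearMap.comp_apply, ContinuousLinearMap.adjoint_inner_right,
    enorm_sq_eq_ofReal, inner_self_eq_norm_sq_to_K]
  norm_cast

theorem adjoint_comp_self_nonneg (A : E →L[ℂ] F) : 0 ≤ A.adjoint ∘L A :=
  (ContinuousLinearMap.nonneg_iff_isPositive _).2
    (ContinuousLinearMap.isPositive_adjoint_comp_self A)

theorem traceAbsPow_two (A : E →L[ℂ] E) : traceAbsPow 2 A = hsSq A := by
  rw [traceAbsPow, CFC.abs_sq, ← trace_adjoint_comp_self]
  rfl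

theorem traceAbsPow_one_of_nonneg {A : E →L[ℂ] E} (hA : 0 ≤ A) : traceAbsPow 1 A = trace A := by
  rw [traceAbsPow, pow_one, CFC.abs_of_nonneg A hA]

theorem traceAbsPow_one_adjoint_comp_self (A : E →L[ℂ] F) :
    traceAbsPow 1 (A.adjoint ∘L A) = hsSq A := by
  rw [traceAbsPow_one_of_nonneg (adjoint_comp_self_nonneg A), trace_adjoint_comp_self]

theorem norm_one_eq (A : E →L[ℂ] E) : norm 1 A = traceAbsPow 1 A := by
  simp [norm]

theorem norm_two_eq (A : E →L[ℂ] E) : norm 2 A = hsSq A ^ (1 / 2 : ℝ) := by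
  rw [norm, traceAbsPow_two]
  norm_num

theorem norm_abs_apply (C : E →L[ℂ] E) (x : E) : ‖CFC.abs C x‖ = ‖C x‖ := by
  have hs : IsSelfAdjoint (CFC.abs C) := (CFC.abs_nonneg C).isSelfAdjoint
  have h1 : ⟪CFC.abs C x, CFC.abs C x⟫_ℂ = ⟪C x, C x⟫_ℂ := by
    rw [← ContinuousLinearMap.adjoint_inner_right C]
    refine (hs.isSymmetric _ _).trans ?_
    exact congrArg (fun D : E →L[ℂ] E => ⟪x, D x⟫_ℂ) (CFC.abs_mul_abs C)
  rw [inner_self_eq_norm_sq_to_K, inner_self_eq_norm_sq_to_K] at h1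
  exact (sq_eq_sq₀ (norm_nonneg _) (norm_nonneg _)).1 (by exact_mod_cast h1)

/-- Each diagonal entry of `|C|` is at most `‖|C| b_i‖ = ‖C b_i‖`. -/
theorem traceAbsPow_one_le_tsum {ι : Type*} (b : HilbertBasis ι ℂ E) (C : E →L[ℂ] E) :
    traceAbsPow 1 C ≤ ∑' i, ‖C (b i)‖ₑ := by
  rw [traceAbsPow, pow_one, trace_eq_tsum b (CFC.abs_nonneg C)]
  refine ENNReal.tsum_le_tsum fun i => ?_
  rw [← ofReal_norm, ← norm_abs_apply]
  refine ENNReal.ofReal_le_ofReal (((Complex.re_le_norm _).trans (norm_inner_le_norm _ _)).trans ?_)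
  rw [b.orthonormal.1 i, one_mul]

/-- The operators `|C| + C` and `|C| - C` are twice the positive and negative parts of `C`, hence
positive. -/
theorem abs_re_inner_le {C : E →L[ℂ] E} (hC : IsSelfAdjoint C) (x : E) :
    ‖⟪x, C x⟫_ℂ‖ ≤ (⟪x, CFC.abs C x⟫_ℂ).re := by
  have hre : ((⟪x, C x⟫_ℂ).re : ℂ) = ⟪x, C x⟫_ℂ :=
    hC.isSymmetric.coe_re_inner_self_apply x
  rw [← hre, Complex.norm_real, Real.norm_eq_abs, abs_le]
  have h1 : 0 ≤ CFC.abs C - C := by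
    rw [CFC.abs_sub_self C hC, two_smul]
    exact add_nonneg (CFC.negPart_nonneg C) (CFC.negPart_nonneg C)
  have h2 : 0 ≤ CFC.abs C + C := by
    rw [CFC.abs_add_self C hC, two_smul]
    exact add_nonneg (CFC.posPart_nonneg C) (CFC.posPart_nonneg C)
  have h3 := ((ContinuousLinearMap.nonneg_iff_isPositive _).1 h1).re_inner_nonneg_right x
  have h4 := ((ContinuousLinearMap.nonneg_iff_isPositive _).1 h2).re_inner_nonneg_right x
  simp only [sub_apply, add_apply, inner_sub_right, inner_add_right, map_sub, map_add,
    RCLike.re_to_complex] at h3 h4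
  constructor <;> linarith

theorem tsum_enorm_inner_le {ι : Type*} (b : HilbertBasis ι ℂ E) {C : E →L[ℂ] E}
    (hC : IsSelfAdjoint C) : ∑' i, ‖⟪b i, C (b i)⟫_ℂ‖ₑ ≤ traceAbsPow 1 C := by
  rw [traceAbsPow, pow_one, trace_eq_tsum b (CFC.abs_nonneg C)]
  refine ENNReal.tsum_le_tsum fun i => ?_
  rw [← ofReal_norm]
  exact ENNReal.ofReal_le_ofReal (abs_re_inner_le hC _)

/-- `‖A* A - B* B‖₁ ≤ (‖A‖₂ + ‖B‖₂) ‖A - B‖₂`. -/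
theorem traceAbsPow_one_sub_le {A B : E →L[ℂ] F} (hA : hsSq A ≠ ∞) (hB : hsSq B ≠ ∞) :
    traceAbsPow 1 (A.adjoint ∘L A - B.adjoint ∘L B) ≤
      (hsSq A ^ (1 / 2 : ℝ) + hsSq B ^ (1 / 2 : ℝ)) * hsSq (A - B) ^ (1 / 2 : ℝ) := by
  set C := A.adjoint ∘L A - B.adjoint ∘L B with hC
  have hc : IsCompactOperator C :=
    ((isCompactOperator_of_hsSq_ne_top hA).clm_comp A.adjoint).sub
      ((isCompactOperator_of_hsSq_ne_top hB).clm_comp B.adjoint)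
  have hs : IsSelfAdjoint C :=
    (adjoint_comp_self_nonneg A).isSelfAdjoint.sub (adjoint_comp_self_nonneg B).isSelfAdjoint
  obtain ⟨ι, b, l, hb⟩ := exists_hilbertBasis_eigenvectors hc hs
  refine (traceAbsPow_one_le_tsum b C).trans ?_
  -- On unit eigenvectors the norm of `C b_i` is the modulus of a diagonal entry, so only the
  -- quadratic form of `C` has to be estimated.
  have h1 : ∀ i, ‖C (b i)‖ₑ = ‖⟪b i, C (b i)⟫_ℂ‖ₑ := fun i => by
    have := b.orthonormal.1 i
    rw [hb, ← ofReal_norm, ← ofReal_norm, inner_smul_right, norm_smul, norm_mul,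
      inner_self_eq_norm_sq_to_K, this]
    simp
  have h2 : ∀ i, ⟪b i, C (b i)⟫_ℂ =
      ⟪A (b i), (A - B) (b i)⟫_ℂ + ⟪(A - B) (b i), B (b i)⟫_ℂ := fun i => by
    simp only [hC, sub_apply, ContinuousLinearMap.comp_apply, inner_sub_right, inner_sub_left,
      ContinuousLinearMap.adjoint_inner_right]
    ring
  have h3 : ∀ i, ‖C (b i)‖ₑ ≤
      ‖A (b i)‖ₑ * ‖(A - B) (b i)‖ₑ + ‖B (b i)‖ₑ * ‖(A - B) (b i)‖ₑ := fun i => by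
    rw [h1, h2, mul_comm ‖B (b i)‖ₑ]
    exact (enorm_add_le _ _).trans (add_le_add (enorm_inner_le _ _) (enorm_inner_le _ _))
  refine (ENNReal.tsum_le_tsum h3).trans ?_
  rw [ENNReal.tsum_add, add_mul]
  simp only [← tsum_enorm_sq_eq_hsSq b]
  exact add_le_add (tsum_mul_le_sqrt_mul_sqrt _ _) (tsum_mul_le_sqrt_mul_sqrt _ _)

theorem hsSq_sub_ne_top {V : Type*} [NormedAddCommGroup V] [InnerProductSpace ℂ V]
    {A B : E →L[ℂ] V} (hA : hsSq A ≠ ∞) (hB : hsSq B ≠ ∞) :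
    hsSq (A - B) ≠ ∞ := by
  -- This is `(s + t)² ≤ 2 s² + 2 t²` after the triangle inequality.
  have h : ∀ i, ‖(A - B) (basis E i)‖ₑ ^ 2 ≤
      2 * ‖A (basis E i)‖ₑ ^ 2 + 2 * ‖B (basis E i)‖ₑ ^ 2 := fun i => by
    rw [enorm_sq_eq_ofReal, enorm_sq_eq_ofReal, enorm_sq_eq_ofReal, ← ENNReal.ofReal_ofNat,
      ← ENNReal.ofReal_mul (by norm_num), ← ENNReal.ofReal_mul (by norm_num),
      ← ENNReal.ofReal_add (by positivity) (by positivity)]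
    refine ENNReal.ofReal_le_ofReal ?_
    rw [sub_apply]
    nlinarith [norm_sub_le (A (basis E i)) (B (basis E i)), norm_nonneg (A (basis E i)),
      norm_nonneg (B (basis E i)), norm_nonneg (A (basis E i) - B (basis E i)),
      sq_nonneg (‖A (basis E i)‖ - ‖B (basis E i)‖)]
  refine ne_top_of_le_ne_top ?_ (ENNReal.tsum_le_tsum h)
  rw [ENNReal.tsum_add, ENNReal.tsum_mul_left, ENNReal.tsum_mul_left]
  exact ENNReal.add_ne_top.2 ⟨ENNReal.mul_ne_top (by simp) hA, ENNReal.mul_ne_top (by simp) hB⟩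

/-- The Powers-Størmer inequality `‖A - B‖₂² ≤ ‖A² - B²‖₁` for positive Hilbert-Schmidt
operators. -/
theorem hsSq_sub_le_traceAbsPow {A B : E →L[ℂ] E} (hA0 : 0 ≤ A) (hB0 : 0 ≤ B)
    (hA : hsSq A ≠ ∞) (hB : hsSq B ≠ ∞) : hsSq (A - B) ≤ traceAbsPow 1 (A * A - B * B) := by
  have hAs : IsSelfAdjoint A := hA0.isSelfAdjoint
  have hBs : IsSelfAdjoint B := hB0.isSelfAdjoint
  obtain ⟨ι, b, l, hb⟩ := exists_hilbertBasis_eigenvectors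
    (isCompactOperator_of_hsSq_ne_top (hsSq_sub_ne_top hA hB)) (hAs.sub hBs)
  have hC : IsSelfAdjoint (A * A - B * B) := by
    refine IsSelfAdjoint.sub ?_ ?_
    · simpa [hAs.star_eq] using IsSelfAdjoint.mul_star_self A
    · simpa [hBs.star_eq] using IsSelfAdjoint.mul_star_self B
  -- In the eigenbasis of `A - B`, with `a` and `c` the diagonal entries of `A` and `B`, it remains
  -- to compare term by term: `l²` on the left, `|l (a + c)|` on the right, where `l = a - c`.
  refine le_trans ?_ (tsum_enorm_inner_le b hC)
  rw [← tsum_enorm_sq_eq_hsSq b]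
  refine ENNReal.tsum_le_tsum fun i => ?_
  have hn := b.orthonormal.1 i
  obtain ⟨a, ha0, ha⟩ : ∃ a : ℝ, 0 ≤ a ∧ ⟪b i, A (b i)⟫_ℂ = a :=
    ⟨_, ((ContinuousLinearMap.nonneg_iff_isPositive _).1 hA0).re_inner_nonneg_right (b i),
      (hAs.isSymmetric.coe_re_inner_self_apply _).symm⟩
  obtain ⟨c, hc0, hc⟩ : ∃ c : ℝ, 0 ≤ c ∧ ⟪b i, B (b i)⟫_ℂ = c :=
    ⟨_, ((ContinuousLinearMap.nonneg_iff_isPositive _).1 hB0).re_inner_nonneg_right (b i),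
      (hBs.isSymmetric.coe_re_inner_self_apply _).symm⟩
  have hAB : A (b i) = B (b i) + (l i : ℂ) • b i := by
    rw [← hb, sub_apply]; abel
  have hl : a - c = l i := by
    have : (a : ℂ) = c + l i := by
      rw [← ha, hAB, inner_add_right, hc, inner_smul_right, inner_self_eq_norm_sq_to_K, hn]
      simp
    have : a = c + l i := by exact_mod_cast this
    linarith
  have hinner : ⟪b i, (A * A - B * B) (b i)⟫_ℂ = ((l i * (a + c) : ℝ) : ℂ) := by
    -- This splitting puts `A - B` next to an eigenvector in both terms, once its self-adjointness
    -- is used in the second.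
    have h1 : (A * A - B * B) (b i) = A ((A - B) (b i)) + (A - B) (B (b i)) := by
      simp only [sub_apply, mul_apply_eq_comp, map_sub]
      abel
    have h2 : ⟪b i, (A - B) (B (b i))⟫_ℂ = ⟪(A - B) (b i), B (b i)⟫_ℂ :=
      ((hAs.sub hBs).isSymmetric _ _).symm
    rw [h1, inner_add_right, h2, hb, map_smul, inner_smul_right, inner_smul_left, ha, hc]
    simp
    ring
  rw [hb, hinner, ← ofReal_norm, ← ofReal_norm, ← ENNReal.ofReal_pow (norm_nonneg _), norm_smul,
    hn, Complex.norm_real, Complex.norm_real, mul_one, Real.norm_eq_abs, Real.norm_eq_abs, sq_abs,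
    abs_mul, abs_of_nonneg (add_nonneg ha0 hc0), sq, ← abs_mul_abs_self]
  refine ENNReal.ofReal_le_ofReal (mul_le_mul_of_nonneg_left ?_ (abs_nonneg _))
  -- Positivity of `A` and `B` enters here: `|a - c| ≤ a + c` for nonnegative `a`, `c`.
  rw [← hl, abs_le]
  constructor <;> linarith

/-! ### The Hilbert-Schmidt inner product -/

theorem hasSum_norm_sq {V : Type*} [NormedAddCommGroup V] [InnerProductSpace ℂ V]
    {A : E →L[ℂ] V} (hA : hsSq A ≠ ∞) :
    HasSum (fun i => ‖A (basis E i)‖ ^ 2) (hsSq A).toReal := by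
  have h := ENNReal.hasSum_toReal (f := fun i => ‖A (basis E i)‖ₑ ^ 2) hA
  simpa [hsSq, ENNReal.tsum_toReal_eq] using h

theorem summable_inner_apply {V : Type*} [NormedAddCommGroup V] [InnerProductSpace ℂ V]
    {A B : E →L[ℂ] V} (hA : hsSq A ≠ ∞) (hB : hsSq B ≠ ∞) :
    Summable fun i => ⟪A (basis E i), B (basis E i)⟫_ℂ := by
  refine Summable.of_norm_bounded ((hasSum_norm_sq hA).summable.add (hasSum_norm_sq hB).summable)
    fun i => (norm_inner_le_norm _ _).trans ?_
  nlinarith [sq_nonneg (‖A (basis E i)‖ - ‖B (basis E i)‖), sq_nonneg ‖A (basis E i)‖,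
    sq_nonneg ‖B (basis E i)‖]

theorem toReal_hsSq_sub {A B : E →L[ℂ] E} (hA : hsSq A ≠ ∞) (hB : hsSq B ≠ ∞) :
    (hsSq (A - B)).toReal = (hsSq A).toReal + (hsSq B).toReal - 2 * (hsInner A B).re := by
  refine (hasSum_norm_sq (hsSq_sub_ne_top hA hB)).unique ?_
  refine (((hasSum_norm_sq hA).add (hasSum_norm_sq hB)).sub
    ((Complex.hasSum_re (summable_inner_apply hA hB).hasSum).mul_left 2)).congr_fun fun i => ?_
  rw [sub_apply, norm_sub_sq (𝕜 := ℂ), RCLike.re_to_complex]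
  ring

theorem hsInner_self {A : E →L[ℂ] E} (hA : hsSq A ≠ ∞) : hsInner A A = (hsSq A).toReal := by
  refine HasSum.tsum_eq ?_
  refine (Complex.hasSum_ofReal.2 (hasSum_norm_sq hA)).congr_fun fun i => ?_
  rw [inner_self_eq_norm_sq_to_K]
  norm_cast

theorem enorm_hsInner_le (A B : E →L[ℂ] E) :
    ‖hsInner A B‖ₑ ≤ hsSq A ^ (1 / 2 : ℝ) * hsSq B ^ (1 / 2 : ℝ) :=
  enorm_tsum_le_tsum_enorm.trans ((ENNReal.tsum_le_tsum fun _ => enorm_inner_le _ _).trans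
    (tsum_mul_le_sqrt_mul_sqrt _ _))

theorem hsInner_sub_right {A B C : E →L[ℂ] E} (hA : hsSq A ≠ ∞) (hB : hsSq B ≠ ∞)
    (hC : hsSq C ≠ ∞) : hsInner A (B - C) = hsInner A B - hsInner A C := by
  rw [hsInner, hsInner, hsInner,
    ← (summable_inner_apply hA hB).tsum_sub (summable_inner_apply hA hC)]
  simp only [sub_apply, inner_sub_right]

end Schatten

/-! ### Operators on continuous fields with prescribed localizations -/

namespace ContinuousField.AdjointableOp

variable {X : Type*} [TopologicalSpace X] [T2Space X] [LocallyCompactSpace X] {H : X → Type*}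
  [∀ u, NormedAddCommGroup (H u)] [∀ u, InnerProductSpace ℂ (H u)] [∀ u, CompleteSpace (H u)]
  {F : ContinuousField X H}

theorem isPositive_iff_loc_nonneg (T : F.AdjointableOp) : T.IsPositive ↔ ∀ u, 0 ≤ T.loc u := by
  constructor
  · intro h u
    rw [ContinuousLinearMap.nonneg_iff_isPositive, ContinuousLinearMap.isPositive_iff_complex]
    intro x
    obtain ⟨ξ, rfl⟩ := exists_section (F := F) u x
    obtain ⟨a, ha, h1⟩ := h ξ u
    rw [c0Inner_apply, ← loc_apply] at h1
    rw [← inner_conj_symm, h1]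
    simpa using ha
  · intro h ξ u
    have hp := (ContinuousLinearMap.nonneg_iff_isPositive _).1 (h u)
    refine ⟨_, hp.re_inner_nonneg_right (ξ u), ?_⟩
    rw [c0Inner_apply, ← loc_apply]
    exact (hp.isSelfAdjoint.isSymmetric.coe_re_inner_self_apply (ξ u)).symm

/-- The operator `T* T`. -/
theorem exists_loc_eq_adjoint_comp_self (T : F.AdjointableOp) :
    ∃ S : F.AdjointableOp, ∀ u, S.loc u = (T.loc u).adjoint ∘L T.loc u := by
  obtain ⟨T', hT'⟩ := T.exists_adjoint
  have hT : ∀ ξ η u, ⟪(T ξ) u, η u⟫_ℂ = ⟪ξ u, (T' η) u⟫_ℂ := fun ξ η u =>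
    DFunLike.congr_fun (hT' ξ η) u
  refine ⟨⟨fun ξ => T' (T ξ), fun ξ => T' (T ξ), fun ξ η => ?_⟩, fun u => ?_⟩
  · ext u
    rw [c0Inner_apply, c0Inner_apply, ← hT, ← inner_conj_symm, ← hT, inner_conj_symm]
  · refine (loc_unique _ u _ fun ξ => ext_inner_left ℂ fun v => ?_).symm
    obtain ⟨η, rfl⟩ := exists_section (F := F) u v
    rw [ContinuousLinearMap.comp_apply, ContinuousLinearMap.adjoint_inner_right, loc_apply,
      loc_apply, hT]

/-- Polynomials in the localizations preserve `C₀(X, H)`; they supply the continuous sections that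
approximate the fibrewise square root. -/
theorem exists_apply_eq_aeval_loc (T : F.AdjointableOp) (p : Polynomial ℝ) (ξ : F.C0) :
    ∃ η : F.C0, ∀ u, η u = Polynomial.aeval (T.loc u) p (ξ u) := by
  induction p using Polynomial.induction_on generalizing ξ with
  | C a =>
    refine ⟨(a : ℂ) • ξ, fun u => ?_⟩
    rw [Polynomial.aeval_C, Algebra.algebraMap_eq_smul_one]
    rfl
  | add p q hp hq =>
    obtain ⟨η, hη⟩ := hp ξ
    obtain ⟨ζ, hζ⟩ := hq ξ
    refine ⟨η + ζ, fun u => ?_⟩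
    rw [map_add, add_apply, ← hη, ← hζ]
    rfl
  | monomial n a h =>
    -- The extra factor acts first, so the induction hypothesis is needed at the section `T ξ`.
    obtain ⟨η, hη⟩ := h (T ξ)
    refine ⟨η, fun u => ?_⟩
    rw [hη, pow_succ, ← mul_assoc, map_mul _ _ Polynomial.X, Polynomial.aeval_X,
      mul_apply_eq_comp, loc_apply]

/-- A uniformly bounded family of self-adjoint operators on the fibres that maps continuous
sections to continuous sections is the family of localizations of an adjointable operator. -/
theorem exists_loc_eq (A : ∀ u, H u →L[ℂ] H u) {c : ℝ} (hc : ∀ u, ‖A u‖ ≤ c)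
    (hs : ∀ u, IsSelfAdjoint (A u)) (hA : ∀ ξ : F.C0, (fun u => A u (ξ u)) ∈ F.sections) :
    ∃ T : F.AdjointableOp, ∀ u, T.loc u = A u := by
  have h0 : ∀ ξ : F.C0, Tendsto (fun u => ‖A u (ξ u)‖) (cocompact X) (𝓝 0) := fun ξ => by
    refine squeeze_zero (fun u => norm_nonneg _) (fun u => (A u).le_of_opNorm_le (hc u) _) ?_
    simpa using ξ.2.2.const_mul c
  let f : F.C0 → F.C0 := fun ξ => ⟨fun u => A u (ξ u), hA ξ, h0 ξ⟩
  refine ⟨⟨f, f, fun ξ η => ?_⟩, fun u => ?_⟩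
  · ext u
    exact (hs u).isSymmetric _ _
  · exact (loc_unique _ u _ fun ξ => rfl).symm

/-- The spectrum of `A` lies in `[0, 1]`, so an error bound on that interval passes to operators.
The bound is the same for every such `A`, hence uniform over fibres. -/
theorem _root_.CFC.norm_aeval_sub_sqrt_le {E : Type*} [NormedAddCommGroup E]
    [InnerProductSpace ℂ E] [CompleteSpace E] {A : E →L[ℂ] E} (hA : 0 ≤ A) (hA1 : ‖A‖ ≤ 1)
    {p : Polynomial ℝ} {ε : ℝ} (hε : 0 ≤ ε)
    (hp : ∀ x ∈ Set.Icc (0 : ℝ) 1, |p.eval x - Real.sqrt x| ≤ ε) :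
    ‖Polynomial.aeval A p - CFC.sqrt A‖ ≤ ε := by
  have hs : IsSelfAdjoint A := hA.isSelfAdjoint
  rw [CFC.sqrt_eq_real_sqrt A hA, cfcₙ_eq_cfc (by fun_prop) Real.sqrt_zero,
    ← cfc_polynomial p A hs, ← cfc_sub _ _ A (by fun_prop) (by fun_prop)]
  refine norm_cfc_le hε fun x hx => hp x ⟨spectrum_nonneg_of_nonneg hA hx, ?_⟩
  exact (le_abs_self x).trans ((spectrum.norm_le_norm_mul_of_mem hx).trans (by
    calc ‖A‖ * ‖(1 : E →L[ℂ] E)‖ ≤ 1 * 1 := by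
          gcongr
          exact ContinuousLinearMap.norm_id_le
      _ = 1 := one_mul 1))

/-- A positive adjointable contraction has an adjointable square root. -/
theorem exists_loc_eq_sqrt (S : F.AdjointableOp) (hS : ∀ u, 0 ≤ S.loc u)
    (hS1 : ∀ u, ‖S.loc u‖ ≤ 1) : ∃ T : F.AdjointableOp, ∀ u, T.loc u = CFC.sqrt (S.loc u) := by
  refine exists_loc_eq (c := 1) _ (fun u => ?_) (fun u => (CFC.sqrt_nonneg _).isSelfAdjoint)
    fun ξ => ?_
  · rw [CFC.norm_sqrt _ (hS u)]
    exact Real.sqrt_le_one.2 (hS1 u)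
  · refine F.mem_of_locally_approx _ fun u ε hε => ?_
    have hpos : 0 < ‖ξ u‖ + 1 := by positivity
    -- Weierstrass approximation. The tolerance is divided by `‖ξ u‖ + 1` because this number bounds
    -- `‖ξ s‖` for `s` near `u`.
    obtain ⟨p, hp⟩ := exists_polynomial_near_of_continuousOn 0 1 Real.sqrt
      (by fun_prop) (ε / (‖ξ u‖ + 1)) (by positivity)
    obtain ⟨η, hη⟩ := exists_apply_eq_aeval_loc S p ξ
    refine ⟨η, η.2.1, ?_⟩
    filter_upwards [((F.continuous_norm ξ ξ.2.1).tendsto u).eventually_lt_const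
      (lt_add_one ‖ξ u‖)] with s hs
    have h1 := CFC.norm_aeval_sub_sqrt_le (hS s) (hS1 s) (by positivity) fun x hx => (hp x hx).le
    have h2 := (Polynomial.aeval (S.loc s) p - CFC.sqrt (S.loc s)).le_of_opNorm_le h1 (ξ s)
    rw [hη, norm_sub_rev]
    refine h2.trans_lt ?_
    rw [div_mul_eq_mul_div, div_lt_iff₀ hpos]
    exact mul_lt_mul_of_pos_left hs hε

end ContinuousField.AdjointableOp

/-! ### The action of the groupoid on operators of the fibres -/

namespace UnitaryRep

variable {X : Type*} [Groupoid X] [TopologicalSpace X] [TopologicalSpace (Arrow X)]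
  {H : X → Type*} [∀ u, NormedAddCommGroup (H u)] [∀ u, InnerProductSpace ℂ (H u)]
  [∀ u, CompleteSpace (H u)] {F : ContinuousField X H}

theorem act_eq (π : UnitaryRep F) (x : Arrow X) (A : H x.left →L[ℂ] H x.left) :
    π.act x A = ((π.toFun x.hom).toContinuousLinearEquiv : H x.left →L[ℂ] H x.right) ∘L A ∘L
      ((π.toFun x.hom).symm.toContinuousLinearEquiv : H x.right →L[ℂ] H x.left) := by
  rw [act, π.map_inv]

theorem hsSq_act (π : UnitaryRep F) (x : Arrow X) (A : H x.left →L[ℂ] H x.left) :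
    Schatten.hsSq (π.act x A) = Schatten.hsSq A := by
  rw [act_eq, Schatten.hsSq_comp_left, Schatten.hsSq_comp_right]

theorem act_mul (π : UnitaryRep F) (x : Arrow X) (A B : H x.left →L[ℂ] H x.left) :
    π.act x (A * B) = π.act x A * π.act x B := by
  ext h
  simp [act_eq, mul_apply_eq_comp]

theorem adjoint_act (π : UnitaryRep F) (x : Arrow X) (A : H x.left →L[ℂ] H x.left) :
    (π.act x A).adjoint = π.act x A.adjoint := by
  refine (ContinuousLinearMap.eq_adjoint_iff _ _).2 (fun h k => ?_) |>.symm
  simp only [act_eq, ContinuousLinearMap.comp_apply]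
  change ⟪π.toFun x.hom (A.adjoint ((π.toFun x.hom).symm h)), k⟫_ℂ =
    ⟪h, π.toFun x.hom (A ((π.toFun x.hom).symm k))⟫_ℂ
  obtain ⟨h, rfl⟩ := (π.toFun x.hom).surjective h
  obtain ⟨k, rfl⟩ := (π.toFun x.hom).surjective k
  simp [ContinuousLinearMap.adjoint_inner_left]

/-- Since the action respects products and adjoints, `x · A` is the square of the self-adjoint
operator `x · √A`. -/
theorem act_nonneg (π : UnitaryRep F) (x : Arrow X) {A : H x.left →L[ℂ] H x.left} (hA : 0 ≤ A) :
    0 ≤ π.act x A := by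
  have hs : (CFC.sqrt A).adjoint = CFC.sqrt A := (CFC.sqrt_nonneg A).isSelfAdjoint
  have h := Schatten.adjoint_comp_self_nonneg (π.act x (CFC.sqrt A))
  rw [adjoint_act, hs] at h
  change 0 ≤ π.act x (CFC.sqrt A) * π.act x (CFC.sqrt A) at h
  rwa [← act_mul, CFC.sqrt_mul_sqrt_self A hA] at h

end UnitaryRep

/-! ### The equivalence -/

theorem TopologicalGroupoid.continuous_left {X : Type*} [Groupoid X] [TopologicalSpace X]
    [TopologicalSpace (Arrow X)] [TopologicalGroupoid X] :
    Continuous (fun x : Arrow X => x.left) :=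
  (TopologicalGroupoid.isEmbedding_unit (X := X)).continuous_iff.2
    TopologicalGroupoid.continuous_unit_left

open ContinuousField Schatten in
/-- Amenability is equivalent to the existence of asymptotically invariant positive trace class
operators: `T ↦ T* T` in one direction, square roots and the Powers-Størmer inequality in the
other. -/
theorem lemma3p3 {X : Type*} [Groupoid X] [TopologicalSpace X] [TopologicalSpace (Arrow X)]
    [TopologicalGroupoid X] [T2Space (Arrow X)] [LocallyCompactSpace (Arrow X)]
    [SecondCountableTopology (Arrow X)]
    {H : X → Type*} [∀ u, NormedAddCommGroup (H u)] [∀ u, InnerProductSpace ℂ (H u)]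
    [∀ u, CompleteSpace (H u)] (F : ContinuousField X H) (hF : F.CountablyGenerated)
    (π : UnitaryRep F) :
    π.IsAmenable ↔
      ∃ (I : Type) (_ : Preorder I) (_ : IsDirectedOrder I) (_ : Nonempty I)
        (S : I → F.AdjointableOp),
        (∀ i, (S i).IsPositive) ∧
        (∀ i, (S i).MemSchatten 1) ∧
        (∀ i, (S i).schattenNorm 1 ≤ 1) ∧
        (∀ K : Set X, IsCompact K →
          TendstoUniformlyOn (fun i u => (Schatten.norm 1 ((S i).loc u)).toReal) (fun _ => 1)
            atTop K) ∧
        (∀ K : Set (Arrow X), IsCompact K → ∀ ε : ℝ≥0∞, 0 < ε →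
          ∀ᶠ i in atTop, ∀ x ∈ K,
            Schatten.norm 1 (π.act x ((S i).loc x.left) - (S i).loc x.right) < ε) := by
  constructor
  · rintro ⟨I, _, _, _, T, hT2, hT1, hTu, hTx⟩
    choose S hS using fun i => (T i).exists_loc_eq_adjoint_comp_self
    have hn2 : ∀ i u, hsSq ((T i).loc u) = Schatten.norm 2 ((T i).loc u) ^ 2 := fun i u => by
      rw [norm_two_eq, ← ENNReal.rpow_two, ← ENNReal.rpow_mul]
      norm_num
    have htr : ∀ i u, traceAbsPow 1 ((S i).loc u) = hsSq ((T i).loc u) := fun i u => by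
      rw [hS, traceAbsPow_one_adjoint_comp_self]
    have hle2 : ∀ i u, Schatten.norm 2 ((T i).loc u) ≤ 1 := fun i u =>
      (le_iSup (fun u => Schatten.norm 2 ((T i).loc u)) u).trans (hT1 i)
    have hle : ∀ i u, hsSq ((T i).loc u) ≤ 1 := fun i u => by
      rw [hn2]
      exact pow_le_one₀ zero_le (hle2 i u)
    have hfin : ∀ i u, hsSq ((T i).loc u) ≠ ∞ := fun i u =>
      ne_top_of_le_ne_top ENNReal.one_ne_top (hle i u)
    refine ⟨I, _, ‹_›, ‹_›, S, fun i => ?_, fun i => ?_, fun i => ?_, fun K hK => ?_,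
      fun K hK ε hε => ?_⟩
    · rw [AdjointableOp.isPositive_iff_loc_nonneg]
      intro u
      rw [hS]
      exact adjoint_comp_self_nonneg _
    · obtain ⟨f, hf⟩ := hT2 i
      exact ⟨f, fun u => by rw [htr, ← traceAbsPow_two, hf]⟩
    · refine iSup_le fun u => ?_
      rw [norm_one_eq, htr]
      exact hle i u
    · rw [Metric.tendstoUniformlyOn_iff]
      intro ε hε
      -- For `t` in `[0, 1]`, `1 - t² ≤ 2 (1 - t)`; hence `ε / 2`.
      filter_upwards [Metric.tendstoUniformlyOn_iff.1 (hTu K hK) (ε / 2) (half_pos hε)]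
        with i hi u hu
      have h1 := hi u hu
      have h2 : (Schatten.norm 2 ((T i).loc u)).toReal ≤ 1 :=
        ENNReal.toReal_le_of_le_ofReal zero_le_one (by simpa using hle2 i u)
      have h3 : 0 ≤ (Schatten.norm 2 ((T i).loc u)).toReal := ENNReal.toReal_nonneg
      rw [norm_one_eq, htr, hn2, ENNReal.toReal_pow]
      rw [Real.dist_eq, abs_of_nonneg (by linarith)] at h1
      rw [Real.dist_eq, abs_of_nonneg (by nlinarith)]
      nlinarith
    -- As `ε` may be infinite, a finite `e < ε` replaces it. If `⟨A, B⟩` is within `e² / 8` of one,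
    -- then `‖A - B‖₂² ≤ 2 - 2 Re ⟨A, B⟩ ≤ (e / 2)²`, and the trace norm is at most `(1 + 1) (e / 2)
    -- = e`.
    · obtain ⟨e, he0, he⟩ := ENNReal.lt_iff_exists_nnreal_btwn.1 hε
      have he0 : (0 : ℝ) < e := by exact_mod_cast he0
      filter_upwards [Metric.tendstoUniformlyOn_iff.1 (hTx K hK) ((e : ℝ) ^ 2 / 8) (by positivity)]
        with i hi x hx
      set A := π.act x ((T i).loc x.left) with hA
      set B := (T i).loc x.right with hB
      have hA1 : hsSq A ≤ 1 := (π.hsSq_act x _).trans_le (hle i _)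
      have hB1 : hsSq B ≤ 1 := hle i _
      have hAt := ne_top_of_le_ne_top ENNReal.one_ne_top hA1
      have hBt := ne_top_of_le_ne_top ENNReal.one_ne_top hB1
      have hSS : π.act x ((S i).loc x.left) - (S i).loc x.right =
          A.adjoint ∘L A - B.adjoint ∘L B := by
        rw [hS, hS, hA, UnitaryRep.adjoint_act]
        congr 1
        exact π.act_mul x _ _
      have hre : 1 - (e : ℝ) ^ 2 / 8 ≤ (hsInner A B).re := by
        have h1 := hi x hx
        rw [dist_eq_norm] at h1
        have h2 := (Complex.re_le_norm _).trans h1.le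
        rw [Complex.sub_re, Complex.one_re] at h2
        linarith
      have hdiff : hsSq (A - B) ≤ ENNReal.ofReal (((e : ℝ) / 2) ^ 2) := by
        rw [← ENNReal.ofReal_toReal (hsSq_sub_ne_top hAt hBt), toReal_hsSq_sub hAt hBt]
        have h1 : (hsSq A).toReal ≤ 1 :=
          ENNReal.toReal_le_of_le_ofReal zero_le_one (by simpa using hA1)
        have h2 : (hsSq B).toReal ≤ 1 :=
          ENNReal.toReal_le_of_le_ofReal zero_le_one (by simpa using hB1)
        exact ENNReal.ofReal_le_ofReal (by nlinarith)
      rw [norm_one_eq, hSS]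
      refine (traceAbsPow_one_sub_le hAt hBt).trans_lt (lt_of_le_of_lt ?_ he)
      calc (hsSq A ^ (1 / 2 : ℝ) + hsSq B ^ (1 / 2 : ℝ)) * hsSq (A - B) ^ (1 / 2 : ℝ)
          ≤ (1 + 1) * ENNReal.ofReal (((e : ℝ) / 2) ^ 2) ^ (1 / 2 : ℝ) := by
            gcongr
            · exact ENNReal.rpow_le_one hA1 (by norm_num)
            · exact ENNReal.rpow_le_one hB1 (by norm_num)
        _ = (1 + 1) * ENNReal.ofReal ((e : ℝ) / 2) := by
            rw [ENNReal.ofReal_rpow_of_nonneg (by positivity) (by norm_num), ← Real.sqrt_eq_rpow,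
              Real.sqrt_sq (by positivity)]
        _ = e := by
            rw [one_add_one_eq_two, ← ENNReal.ofReal_ofNat, ← ENNReal.ofReal_mul (by norm_num),
              mul_div_cancel₀ _ (by norm_num), ENNReal.ofReal_coe_nnreal]
  · rintro ⟨I, _, _, _, S, hS0, hS1, hSn, hSu, hSx⟩
    have hpos : ∀ i u, 0 ≤ (S i).loc u := fun i =>
      (AdjointableOp.isPositive_iff_loc_nonneg _).1 (hS0 i)
    have hle : ∀ i u, traceAbsPow 1 ((S i).loc u) ≤ 1 := fun i u => by
      rw [← norm_one_eq]
      exact (le_iSup (fun u => Schatten.norm 1 ((S i).loc u)) u).trans (hSn i)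
    have hsqrt : ∀ i u, hsSq (CFC.sqrt ((S i).loc u)) = traceAbsPow 1 ((S i).loc u) :=
      fun i u => by rw [traceAbsPow_one_of_nonneg (hpos i u), trace_eq_hsSq_sqrt (hpos i u)]
    -- `‖S_u‖ = ‖√S_u‖² ≤ ‖√S_u‖₂² = tr S_u ≤ 1`, as the construction of the adjointable square root
    -- requires.
    have hcontr : ∀ i u, ‖(S i).loc u‖ ≤ 1 := fun i u => by
      have h1 := (enorm_sq_le_hsSq (CFC.sqrt ((S i).loc u))).trans
        ((hsqrt i u).trans_le (hle i u))
      rw [enorm_sq_eq_ofReal, CFC.norm_sqrt _ (hpos i u), Real.sq_sqrt (norm_nonneg _)] at h1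
      exact ENNReal.ofReal_le_one.1 h1
    choose T hT using fun i => AdjointableOp.exists_loc_eq_sqrt (S i) (hpos i) (hcontr i)
    have hTS : ∀ i u, hsSq ((T i).loc u) = traceAbsPow 1 ((S i).loc u) := fun i u => by
      rw [hT, hsqrt]
    have hdist : ∀ K : Set X, IsCompact K → ∀ ε > 0, ∀ᶠ i in atTop, ∀ u ∈ K,
        |(1 : ℝ) - (hsSq ((T i).loc u)).toReal| < ε := fun K hK ε hε => by
      filter_upwards [Metric.tendstoUniformlyOn_iff.1 (hSu K hK) ε hε] with i hi u hu
      have h1 := hi u hu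
      rwa [norm_one_eq, ← hTS, Real.dist_eq] at h1
    refine ⟨I, _, ‹_›, ‹_›, T, fun i => ?_, fun i => ?_, fun K hK => ?_, fun K hK => ?_⟩
    · obtain ⟨f, hf⟩ := hS1 i
      exact ⟨f, fun u => by rw [traceAbsPow_two, hTS, hf]⟩
    · refine iSup_le fun u => ?_
      rw [norm_two_eq, hTS]
      exact ENNReal.rpow_le_one (hle i u) (by norm_num)
    · rw [Metric.tendstoUniformlyOn_iff]
      intro ε hε
      filter_upwards [hdist K hK ε hε] with i hi u hu
      refine lt_of_le_of_lt ?_ (hi u hu)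
      rw [norm_two_eq, ← ENNReal.toReal_rpow, ← Real.sqrt_eq_rpow, Real.dist_eq]
      set t := (hsSq ((T i).loc u)).toReal with ht
      have ht0 : 0 ≤ t := ENNReal.toReal_nonneg
      -- The second factor is at least one, so `|1 - √t| ≤ |1 - t|`.
      have h1 : 1 - t = (1 - √t) * (1 + √t) := by
        linear_combination Real.sq_sqrt ht0
      rw [h1, abs_mul]
      refine le_mul_of_one_le_right (abs_nonneg _) ?_
      rw [abs_of_nonneg (by positivity)]
      linarith [Real.sqrt_nonneg t]
    · rw [Metric.tendstoUniformlyOn_iff]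
      intro ε hε
      -- The square compensates for the square in the Powers-Størmer inequality. The other half of
      -- `ε` controls `1 - ‖A‖₂²`, which depends only on `d(x)`, a point of the compact set `d(K)`.
      filter_upwards [hSx K hK (ENNReal.ofReal ((ε / 2) ^ 2)) (ENNReal.ofReal_pos.2 (by positivity)),
        hdist _ (hK.image TopologicalGroupoid.continuous_left) (ε / 2) (half_pos hε)]
        with i hi1 hi2 x hx
      set A := π.act x ((T i).loc x.left) with hA
      set B := (T i).loc x.right with hB
      have hAS : hsSq A = hsSq ((T i).loc x.left) := π.hsSq_act x _
      have hA1 : hsSq A ≤ 1 := by rw [hAS, hTS]; exact hle i _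
      have hB1 : hsSq B ≤ 1 := by rw [hB, hTS]; exact hle i _
      have hAt := ne_top_of_le_ne_top ENNReal.one_ne_top hA1
      have hBt := ne_top_of_le_ne_top ENNReal.one_ne_top hB1
      have hloc : ∀ u, (T i).loc u * (T i).loc u = (S i).loc u := fun u => by
        rw [hT, CFC.sqrt_mul_sqrt_self _ (hpos i u)]
      have hTpos : ∀ u, 0 ≤ (T i).loc u := fun u => by
        rw [hT]
        exact CFC.sqrt_nonneg _
      have h1 : hsSq (A - B) < ENNReal.ofReal ((ε / 2) ^ 2) := by
        refine (hsSq_sub_le_traceAbsPow (π.act_nonneg x (hTpos _)) (hTpos _) hAt hBt).trans_lt ?_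
        rw [← UnitaryRep.act_mul, hloc, hloc, ← norm_one_eq]
        exact hi1 x hx
      have h2 : ‖hsInner A (A - B)‖ < ε / 2 := by
        have h3 : ‖hsInner A (A - B)‖ₑ < ENNReal.ofReal (ε / 2) := by
          calc ‖hsInner A (A - B)‖ₑ ≤ hsSq A ^ (1 / 2 : ℝ) * hsSq (A - B) ^ (1 / 2 : ℝ) :=
                enorm_hsInner_le _ _
            _ ≤ hsSq (A - B) ^ (1 / 2 : ℝ) :=
                mul_le_of_le_one_left zero_le (ENNReal.rpow_le_one hA1 (by norm_num))
            _ < ENNReal.ofReal ((ε / 2) ^ 2) ^ (1 / 2 : ℝ) :=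
                ENNReal.rpow_lt_rpow h1 (by norm_num)
            _ = ENNReal.ofReal (ε / 2) := by
                rw [ENNReal.ofReal_rpow_of_nonneg (by positivity) (by norm_num),
                  ← Real.sqrt_eq_rpow, Real.sqrt_sq (by positivity)]
        rw [← ofReal_norm] at h3
        exact (ENNReal.ofReal_lt_ofReal_iff (half_pos hε)).1 h3
      have h4 := hi2 _ ⟨x, hx, rfl⟩
      rw [← hAS] at h4
      -- Expanding around `⟨A, A⟩ = ‖A‖₂²` controls the whole complex number `⟨A, B⟩`, whereas `‖A -
      -- B‖₂²` by polarization would only give its real part.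
      have h5 : (1 : ℂ) - hsInner A B =
          ((1 - (hsSq A).toReal : ℝ) : ℂ) + hsInner A (A - B) := by
        rw [hsInner_sub_right hAt hAt hBt, hsInner_self hAt]
        push_cast
        ring
      rw [dist_eq_norm, h5]
      refine (norm_add_le _ _).trans_lt ?_
      rw [Complex.norm_real, Real.norm_eq_abs]
      linarith
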